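/- Let $N\subseteq M$ be a connected unital inclusion of finite-dimensional $C^*$-algebras, i.e. $N$ is a unital $*$-subalgebra of $M$ and $Z(N)\cap Z(M)=\mathbb C1$ (equivalently, the Bratteli diagram of the inclusion is connected). For a faithful tracial state $tr$ on $M$, let $e_1$ be the orthogonal projection of $L^2(M,tr)$ onto the subspace $L^2(N,tr)$, and let $M_1=\langle M,e_1\rangle$ be the basic construction, i.e. the $*$-algebra of operators on $L^2(M,tr)$ generated by $e_1$ and by $M$ acting by left multiplication. Let $tr$ be the Markov trace of the inclusion, of modulus $\tau$: a faithful tracial state on $M$ that extends to a positive trace $Tr$ on $M_1$ with $Tr(xe_1)=\tau\,tr(x)$ for all $x\in M$. Let $\alpha_0$ be a $*$-automorphism of $M$ with $\alpha_0(N)=N$. Then there is a unique $*$-automorphism $\alpha_1$ of $M_1$ such that $\alpha_1(e_1)=e_1$, $\alpha_1(M)=M$ and $\alpha_1|_M=\alpha_0$. Moreover, $\alpha_1$ is trace-preserving, i.e. $Tr\circ\alpha_1=Tr$ for the extension $Tr$ of $tr$ to $M_1$. -/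

import Mathlib

open scoped ComplexOrder

noncomputable section

namespace JonesTower

variable {M : Type*} [CStarAlgebra M] [PartialOrder M] [StarOrderedRing M]

/-- A unital inclusion `N ⊆ M` of finite-dimensional C*-algebras is connected when the centres of
`N` and `M` meet only in the scalars (equivalently, its Bratteli diagram is connected). -/
def IsConnectedInclusion {M : Type*} [CStarAlgebra M] (N : StarSubalgebra ℂ M) : Prop :=
  ∀ z ∈ N, (∀ y ∈ N, Commute z y) → (∀ y : M, Commute z y) → ∃ c : ℂ, z = algebraMap ℂ M c

/-- A faithful tracial state. -/
structure IsFaithfulTracialState (tr : M →ₚ[ℂ] ℂ) : Prop where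
  map_one : tr 1 = 1
  trace : ∀ x y : M, tr (x * y) = tr (y * x)
  faithful : ∀ x : M, tr (star x * x) = 0 → x = 0

/-- The canonical map `M → L²(M, tr)` into the GNS Hilbert space, whose inner product is
`⟪x, y⟫ = tr (x* y)`. -/
def toL2 (tr : M →ₚ[ℂ] ℂ) : M →ₗ[ℂ] tr.GNS :=
  (UniformSpace.Completion.toComplL (𝕜 := ℂ) (E := tr.PreGNS)).toLinearMap ∘ₗ
    tr.toPreGNS.toLinearMap

/-- The subspace `L²(N, tr)` of `L²(M, tr)`: the closure of the image of `N`. -/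
def subL2 (N : StarSubalgebra ℂ M) (tr : M →ₚ[ℂ] ℂ) : Submodule ℂ tr.GNS :=
  ((Subalgebra.toSubmodule N.toSubalgebra).map (toL2 tr)).topologicalClosure

/-- `subL2 N tr` is complete, being closed in a Hilbert space. -/
instance instCompleteSubL2 (N : StarSubalgebra ℂ M) (tr : M →ₚ[ℂ] ℂ) :
    CompleteSpace (subL2 N tr) :=
  (Submodule.isClosed_topologicalClosure _).completeSpace_coe

/-- The Jones projection `e₁`: the orthogonal projection of `L²(M, tr)` onto `L²(N, tr)`. -/
def jonesProj (N : StarSubalgebra ℂ M) (tr : M →ₚ[ℂ] ℂ) : tr.GNS →L[ℂ] tr.GNS :=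
  (subL2 N tr).starProjection

/-- The basic construction `M₁ = ⟨M, e₁⟩`: the *-algebra of operators on `L²(M, tr)` generated by
the left multiplications by elements of `M` and by `e₁`. For finite-dimensional `M` the space
`L²(M, tr)` is finite-dimensional, so that this is also the von Neumann algebra they generate. -/
def basicConstruction (N : StarSubalgebra ℂ M) (tr : M →ₚ[ℂ] ℂ) :
    StarSubalgebra ℂ (tr.GNS →L[ℂ] tr.GNS) :=
  StarAlgebra.adjoin ℂ (Set.range tr.gnsStarAlgHom ∪ {jonesProj N tr})

/-- `M` inside its basic construction, acting by left multiplication. -/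
def incl (N : StarSubalgebra ℂ M) (tr : M →ₚ[ℂ] ℂ) : M →⋆ₐ[ℂ] basicConstruction N tr :=
  tr.gnsStarAlgHom.codRestrict (basicConstruction N tr) fun x =>
    StarAlgebra.subset_adjoin ℂ _ (Or.inl ⟨x, rfl⟩)

/-- `e₁` as an element of the basic construction. -/
def e₁ (N : StarSubalgebra ℂ M) (tr : M →ₚ[ℂ] ℂ) : basicConstruction N tr :=
  ⟨jonesProj N tr, StarAlgebra.subset_adjoin ℂ _ (Or.inr rfl)⟩

/-- `Tr` is a positive trace on `M₁` that extends `tr` and satisfies `Tr (x e₁) = τ tr x` for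
`x ∈ M`. -/
structure IsMarkovExtension (N : StarSubalgebra ℂ M) (tr : M →ₚ[ℂ] ℂ) (τ : ℝ)
    (Tr : basicConstruction N tr →ₗ[ℂ] ℂ) : Prop where
  nonneg : ∀ x, 0 ≤ Tr (star x * x)
  trace : ∀ x y, Tr (x * y) = Tr (y * x)
  extends_tr : ∀ x : M, Tr (incl N tr x) = tr x
  markov : ∀ x : M, Tr (incl N tr x * e₁ N tr) = (τ : ℂ) * tr x

/-- `tr` is a Markov trace of modulus `τ` for the inclusion `N ⊆ M`. -/
def IsMarkovTrace (N : StarSubalgebra ℂ M) (tr : M →ₚ[ℂ] ℂ) (τ : ℝ) : Prop :=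
  IsFaithfulTracialState tr ∧ ∃ Tr, IsMarkovExtension N tr τ Tr

/-- The *-automorphism `α₁` of `M₁` fixes `e₁`, maps `M` onto itself, and restricts to `α₀`
on `M`. -/
structure IsCompatibleExtension (N : StarSubalgebra ℂ M) (tr : M →ₚ[ℂ] ℂ) (α₀ : M ≃⋆ₐ[ℂ] M)
    (α₁ : basicConstruction N tr ≃⋆ₐ[ℂ] basicConstruction N tr) : Prop where
  map_e₁ : α₁ (e₁ N tr) = e₁ N tr
  image_M : α₁ '' Set.range (incl N tr) = Set.range (incl N tr)
  restrict : ∀ x : M, α₁ (incl N tr x) = incl N tr (α₀ x)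

end JonesTower

end

noncomputable section

namespace JonesTower

/-! The heart of the matter is that `α₀` preserves `tr`, because a connected inclusion has only one
Markov trace of a given modulus (`IsDensity.unique`). Conjugation by the unitary `x ↦ α₀ x` of
`L²(M, tr)` then fixes `e₁`, carries left multiplication by `x` to left multiplication by `α₀ x`,
and so restricts to the desired `α₁`. The products `x e₁ y` span `M₁`, and `Tr (x e₁ y) = τ tr (y
x)`, so `α₁` is unique and preserves `Tr`.

Uniqueness of the trace is a Perron–Frobenius argument without matrices. A Markov trace has an
invertible positive density `s` in the centre of `N`: on `N` it is the trace of right multiplication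
by `n s` on `N`, and on `M` it is `τ` times the trace of `x ↦ y x s` on `M` (`exists_isDensity`).
The second formula comes from the Pimsner–Popa identity `∑ bⱼ s e₁ bⱼ* = 1`. Comparing the two
formulas on `N` gives an eigenvector equation for `s`, with connectedness as irreducibility: for two
densities, subtract the largest multiple of one that leaves the other positive; the kernel
projection of the difference is central in `N` and in `M`, hence scalar, and the difference vanishes
(`IsDensity.eq_smul`). -/

/-- A finite family of vectors reproducing every vector from coefficients given by inner products
in a Hilbert space into which the ambient space embeds. -/
theorem exists_frame {V H : Type*} [AddCommGroup V] [Module ℂ V] [FiniteDimensional ℂ V]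
    [NormedAddCommGroup H] [InnerProductSpace ℂ H] (ι : V →ₗ[ℂ] H) (hι : Function.Injective ι) :
    ∃ (n : ℕ) (v : Fin n → V), ∀ x, ∑ i, inner ℂ (ι (v i)) (ι x) • v i = x := by
  let e := LinearEquiv.ofInjective ι hι
  let b := stdOrthonormalBasis ℂ (LinearMap.range ι)
  refine ⟨_, fun i => e.symm (b i), fun x => ?_⟩
  apply e.injective
  rw [map_sum]
  refine Eq.trans ?_ (b.sum_repr (e x))
  refine Finset.sum_congr rfl fun i _ => ?_
  rw [map_smul, e.apply_symm_apply, b.repr_apply_apply]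
  congr 1
  have h1 : ι (e.symm (b i)) = (b i : H) := by
    rw [← LinearEquiv.ofInjective_apply ι (h := hι)]
    exact congrArg Subtype.val (e.apply_symm_apply (b i))
  rw [h1]
  rfl

/-- The frame identity writes `A` as a sum of rank-one maps. -/
theorem trace_eq_sum_of_frame {V ι : Type*} [AddCommGroup V] [Module ℂ V] [FiniteDimensional ℂ V]
    [Fintype ι] (φ : ι → V →ₗ[ℂ] ℂ) (v : ι → V) (h : ∀ x, ∑ i, φ i x • v i = x)
    (A : V →ₗ[ℂ] V) : LinearMap.trace ℂ V A = ∑ i, φ i (A (v i)) := by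
  have hA : A = ∑ i, ((φ i ∘ₗ A).smulRight (v i)) := by
    ext x
    simpa using (h (A x)).symm
  conv_lhs => rw [hA]
  rw [map_sum]
  exact Finset.sum_congr rfl fun i _ => LinearMap.trace_smulRight _ _

/-! ### The GNS space and the Jones projection. -/

section GNS

variable {M : Type*} [CStarAlgebra M] [PartialOrder M] [StarOrderedRing M]
  {tr : M →ₚ[ℂ] ℂ} {N : StarSubalgebra ℂ M}

theorem inner_toL2 (x y : M) : inner ℂ (toL2 tr x) (toL2 tr y) = tr (star x * y) :=
  (UniformSpace.Completion.inner_coe (tr.toPreGNS x) (tr.toPreGNS y)).trans rfl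

theorem gnsStarAlgHom_toL2 (x y : M) : tr.gnsStarAlgHom x (toL2 tr y) = toL2 tr (x * y) :=
  tr.gnsNonUnitalStarAlgHom_apply_coe (a := x) (b := tr.toPreGNS y)

theorem toL2_injective (h : IsFaithfulTracialState tr) : Function.Injective (toL2 tr) := by
  rw [injective_iff_map_eq_zero]
  intro x hx
  apply h.faithful
  rw [← inner_toL2, hx, inner_zero_left]

theorem toL2_surjective [FiniteDimensional ℂ M] : Function.Surjective (toL2 tr) := by
  rw [← LinearMap.range_eq_top]
  have hc : IsClosed (LinearMap.range (toL2 tr) : Set tr.GNS) :=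
    Submodule.closed_of_finiteDimensional _
  have hd : DenseRange (toL2 tr) :=
    (UniformSpace.Completion.denseRange_coe (α := tr.PreGNS)).comp
      tr.toPreGNS.surjective.denseRange (UniformSpace.Completion.continuous_coe _)
  apply SetLike.coe_injective
  rw [← hc.closure_eq, LinearMap.coe_range, hd.closure_range]
  rfl

theorem ext_toL2 [FiniteDimensional ℂ M] {A B : tr.GNS →L[ℂ] tr.GNS}
    (h : ∀ x, A (toL2 tr x) = B (toL2 tr x)) : A = B := by
  ext ξ
  obtain ⟨x, rfl⟩ := toL2_surjective ξ
  exact h x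

theorem toL2_mem_subL2 {y : M} (hy : y ∈ N) : toL2 tr y ∈ subL2 N tr :=
  Submodule.le_topologicalClosure _ ⟨y, hy, rfl⟩

theorem jonesProj_toL2_eq {z y : M} (hy : y ∈ N) (h : ∀ n ∈ N, tr (n * (z - y)) = 0) :
    jonesProj N tr (toL2 tr z) = toL2 tr y := by
  refine Submodule.eq_starProjection_of_mem_orthogonal (toL2_mem_subL2 hy) ?_
  rw [subL2, Submodule.orthogonal_closure, Submodule.mem_orthogonal]
  rintro _ ⟨n, hn, rfl⟩
  rw [← map_sub, inner_toL2]
  exact h _ (star_mem hn)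

theorem exists_frame_of_injective {V : Type*} [AddCommGroup V] [Module ℂ V]
    [FiniteDimensional ℂ V] (h : IsFaithfulTracialState tr) (j : V →ₗ[ℂ] M)
    (hj : Function.Injective j) :
    ∃ (n : ℕ) (v : Fin n → V), ∀ x, ∑ i, tr (star (j (v i)) * j x) • v i = x := by
  obtain ⟨n, v, hv⟩ := exists_frame (toL2 tr ∘ₗ j) ((toL2_injective h).comp hj)
  exact ⟨n, v, fun x => by simpa [inner_toL2] using hv x⟩

theorem jonesProj_toL2_frame {ι : Type*} [Fintype ι] {v : ι → N}
    (hv : ∀ x : N, ∑ i, tr (star (v i : M) * x) • v i = x) (z : M) :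
    jonesProj N tr (toL2 tr z) = toL2 tr (∑ i, tr (star (v i : M) * z) • (v i : M)) := by
  refine jonesProj_toL2_eq (sum_mem fun i _ => SMulMemClass.smul_mem _ (v i).2) fun n hn => ?_
  -- This is the adjoint of the frame expansion of `star n`.
  have h1 : ∑ i, tr (n * v i) • star (v i : M) = n := by
    have := congrArg (fun x : N => star (x : M)) (hv ⟨star n, star_mem hn⟩)
    simp only [AddSubmonoidClass.coe_finsetSum, SetLike.val_smul, star_sum, star_smul,
      star_star] at this
    refine Eq.trans (Finset.sum_congr rfl fun i _ => ?_) this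
    rw [← map_star, star_mul, star_star, star_star]
  rw [mul_sub, map_sub, sub_eq_zero]
  conv_lhs => rw [← h1]
  simp only [Finset.sum_mul, Finset.mul_sum, map_sum, smul_mul_assoc, mul_smul_comm, map_smul,
    smul_eq_mul]
  exact Finset.sum_congr rfl fun i _ => mul_comm _ _

instance finiteDimensional_starSubalgebra [FiniteDimensional ℂ M] (N : StarSubalgebra ℂ M) :
    FiniteDimensional ℂ N :=
  FiniteDimensional.finiteDimensional_submodule (Subalgebra.toSubmodule N.toSubalgebra)

theorem exists_jonesProj_toL2 [FiniteDimensional ℂ M] (h : IsFaithfulTracialState tr) (z : M) :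
    ∃ y ∈ N, jonesProj N tr (toL2 tr z) = toL2 tr y := by
  obtain ⟨n, v, hv⟩ := exists_frame_of_injective h N.subtype.toLinearMap
    Subtype.val_injective
  exact ⟨_, sum_mem fun i _ => SMulMemClass.smul_mem _ (v i).2, jonesProj_toL2_frame hv z⟩

theorem trace_mul_sub_eq_zero {z y m : M} (hz : jonesProj N tr (toL2 tr z) = toL2 tr y)
    (hm : m ∈ N) : tr (m * (z - y)) = 0 := by
  have h1 : toL2 tr z - toL2 tr y ∈ (subL2 N tr)ᗮ := by
    rw [← hz]
    exact Submodule.sub_starProjection_mem_orthogonal _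
  have h2 := Submodule.inner_right_of_mem_orthogonal
    (toL2_mem_subL2 (tr := tr) (star_mem hm)) h1
  rwa [← map_sub, inner_toL2, star_star] at h2

/-- By traciality, orthogonality to `N` survives right multiplication by `n`. -/
theorem jonesProj_toL2_mul (h : IsFaithfulTracialState tr) {z y n : M} (hy : y ∈ N) (hn : n ∈ N)
    (hz : jonesProj N tr (toL2 tr z) = toL2 tr y) :
    jonesProj N tr (toL2 tr (z * n)) = toL2 tr (y * n) := by
  refine jonesProj_toL2_eq (mul_mem hy hn) fun m hm => ?_
  rw [← sub_mul, ← mul_assoc, h.trace, ← mul_assoc, trace_mul_sub_eq_zero hz (mul_mem hn hm)]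

/-- The relation `e₁ x e₁ = E(x) e₁`, where `y` plays the role of the conditional expectation
`E(x)`. -/
theorem jonesProj_mul_gns_mul_jonesProj [FiniteDimensional ℂ M] (h : IsFaithfulTracialState tr)
    {x y : M} (hy : y ∈ N) (hx : jonesProj N tr (toL2 tr x) = toL2 tr y) :
    jonesProj N tr * tr.gnsStarAlgHom x * jonesProj N tr =
      tr.gnsStarAlgHom y * jonesProj N tr := by
  refine ext_toL2 fun z => ?_
  obtain ⟨n, hn, hz⟩ := exists_jonesProj_toL2 (N := N) h z
  change jonesProj N tr (tr.gnsStarAlgHom x (jonesProj N tr (toL2 tr z))) =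
    tr.gnsStarAlgHom y (jonesProj N tr (toL2 tr z))
  rw [hz, gnsStarAlgHom_toL2, gnsStarAlgHom_toL2]
  exact jonesProj_toL2_mul h hy hn hx

end GNS

/-! ### Densities of Markov traces and the Pimsner–Popa basis. -/

section Density

variable {M : Type*} [CStarAlgebra M] [PartialOrder M] [StarOrderedRing M]

/-- `s ∈ Z(N)` is the density of the linear functional `f`, relative to the canonical traces of the
right regular representation of `N` and of `M` as an `M`-`N`-bimodule. -/
structure IsDensity (N : StarSubalgebra ℂ M) (f : M →ₗ[ℂ] ℂ) (τ : ℂ) (s : N) : Prop where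
  comm : ∀ n : N, Commute s n
  nonneg : 0 ≤ (s : M)
  exists_inv : ∃ t : N, 0 ≤ (t : M) ∧ t * s = 1
  trace_right : ∀ n : N, LinearMap.trace ℂ N (LinearMap.mulRight ℂ (n * s)) = f n
  trace_bimodule : ∀ y : M,
    τ * LinearMap.trace ℂ M (LinearMap.mulLeft ℂ y * LinearMap.mulRight ℂ (s : M)) = f y

theorem isSelfAdjoint_of_star_eq {A : Type*} [Mul A] [StarMul A] {q : A}
    (h : star q = star q * q) : IsSelfAdjoint q := by
  have := IsSelfAdjoint.star_mul_self q
  rw [← h] at this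
  simpa [IsSelfAdjoint, eq_comm] using this

open Polynomial in
/-- The kernel projection of a self-adjoint element of a finite-dimensional algebra is a polynomial
in that element. -/
theorem exists_kernel_projection {A : Type*} [CStarAlgebra A] [FiniteDimensional ℂ A] {v : A}
    (hv : IsSelfAdjoint v) (hu : ¬ IsUnit v) :
    ∃ q ∈ Algebra.adjoin ℂ {v}, ∃ k : A, IsSelfAdjoint q ∧ q * q = q ∧ q ≠ 0 ∧ q * v = 0 ∧
      1 - q = v * k := by
  obtain ⟨p, hp⟩ : ∃ p, p = minpoly ℂ v := ⟨_, rfl⟩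
  have hne : p ≠ 0 := hp ▸ minpoly.ne_zero_of_finite ℂ v
  have hc (r : ℂ[X]) : v * aeval v r = aeval v r * v := by
    simpa using congrArg (aeval v) (X_mul (p := r))
  have hdiv (r : ℂ[X]) : aeval v r = v * aeval v r.divX + algebraMap ℂ A (r.coeff 0) := by
    conv_lhs => rw [← r.X_mul_divX_add]
    rw [map_add, map_mul, aeval_X, aeval_C]
  have hp0 : aeval v p = 0 := hp ▸ minpoly.aeval ℂ v
  have hcoeff : p.coeff 0 = 0 := by
    by_contra h0
    apply hu
    have h1 : v * aeval v p.divX = - algebraMap ℂ A (p.coeff 0) :=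
      eq_neg_of_add_eq_zero_left ((hdiv p).symm.trans hp0)
    have h2 : IsUnit (v * aeval v p.divX) := by
      rw [h1]
      exact ((isUnit_iff_ne_zero.2 h0).map (algebraMap ℂ A)).neg
    exact ((show Commute v _ from hc _).isUnit_mul_iff.1 h2).1
  obtain ⟨g, hg⟩ : ∃ g, g = p.divX := ⟨_, rfl⟩
  have hvg : v * aeval v g = 0 := by
    have := hdiv p
    rw [hp0, hcoeff, map_zero, add_zero] at this
    rw [hg, ← this]
  have hg0 : aeval v g ≠ 0 := by
    intro h0
    have hg1 : g ≠ 0 := by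
      rw [hg, Ne, divX_eq_zero_iff, hcoeff, map_zero]
      exact hne
    have h1 : p.degree ≤ g.degree := degree_le_of_dvd (hp ▸ minpoly.dvd ℂ v h0) hg1
    exact absurd (hg ▸ degree_divX_lt hne) (not_lt.2 h1)
  -- Zero is a simple root of the minimal polynomial `X * g`: otherwise `g(v) = v r(v)`, so `g(v)*
  -- g(v) = r(v)* v g(v) = 0`.
  have hgc : g.coeff 0 ≠ 0 := by
    intro h0
    apply hg0
    have h1 := hdiv g
    rw [h0, map_zero, add_zero] at h1
    rw [← CStarRing.star_mul_self_eq_zero_iff, h1, star_mul, hv.star_eq, mul_assoc, ← h1, hvg,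
      mul_zero]
  -- Dividing by the constant term makes `1 - q` a multiple of `v`, while `q v = v q = 0`.
  obtain ⟨q, hq⟩ : ∃ q, q = (g.coeff 0)⁻¹ • aeval v g := ⟨_, rfl⟩
  have hqv : q * v = 0 := by rw [hq, smul_mul_assoc, ← hc, hvg, smul_zero]
  have hvq : v * q = 0 := by rw [hq, mul_smul_comm, hvg, smul_zero]
  have hk : 1 - q = v * (-((g.coeff 0)⁻¹ • aeval v g.divX)) := by
    rw [hq, hdiv g, smul_add, Algebra.algebraMap_eq_smul_one, smul_smul, inv_mul_cancel₀ hgc,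
      one_smul, mul_neg, mul_smul_comm]
    abel
  refine ⟨q, ?_, _, isSelfAdjoint_of_star_eq ?_, ?_, ?_, hqv, hk⟩
  · rw [hq]
    exact Subalgebra.smul_mem _ (aeval_mem_adjoin_singleton _ _) _
  · have : star q * (1 - q) = 0 := by
      rw [hk, ← mul_assoc, ← hv.star_eq, ← star_mul, hvq, star_zero, zero_mul]
    rwa [mul_sub, mul_one, sub_eq_zero] at this
  · have : q * (1 - q) = 0 := by rw [hk, ← mul_assoc, hqv, zero_mul]
    rw [mul_sub, mul_one, sub_eq_zero] at this
    exact this.symm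
  · rw [hq]
    exact smul_ne_zero (inv_ne_zero hgc) hg0

theorem trace_mulRight_mul_comm {A : Type*} [Ring A] [Algebra ℂ A] (a b : A) :
    LinearMap.trace ℂ A (LinearMap.mulRight ℂ (a * b)) =
      LinearMap.trace ℂ A (LinearMap.mulRight ℂ (b * a)) := by
  rw [LinearMap.mulRight_mul, LinearMap.mulRight_mul]
  exact LinearMap.trace_mul_comm ℂ _ _

variable {N : StarSubalgebra ℂ M}

/-- Both canonical traces are invariant under conjugation by `α`, so the preimage of `s` is a
density for the transported functional. -/
theorem IsDensity.comp_starAlgEquiv {f : M →ₗ[ℂ] ℂ} {τ : ℂ} {s : N} (hf : IsDensity N f τ s)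
    (α : M ≃⋆ₐ[ℂ] M) (hα : ∀ x, α x ∈ N ↔ x ∈ N) :
    ∃ s' : N, IsDensity N (f ∘ₗ (α : M →ₗ[ℂ] M)) τ s' := by
  let β : N ≃ₐ[ℂ] N :=
    { toFun := fun x => ⟨α x, (hα x).2 x.2⟩
      invFun := fun x => ⟨α.symm x, (hα _).1 (by simp)⟩
      left_inv := fun x => by simp
      right_inv := fun x => by simp
      map_mul' := fun x y => by ext; simp
      map_add' := fun x y => by ext; simp
      commutes' := fun r => by ext; simp [Algebra.algebraMap_eq_smul_one] }
  have hβ (x : N) : (β x : M) = α x := rfl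
  have hαnn (x : M) (hx : 0 ≤ x) : 0 ≤ α.symm x := by
    obtain ⟨d, rfl⟩ := CStarAlgebra.nonneg_iff_eq_star_mul_self.1 hx
    rw [map_mul, map_star]
    exact star_mul_self_nonneg _
  refine ⟨β.symm s, fun n => ?_, ?_, ?_, fun n => ?_, fun y => ?_⟩
  · have := (hf.comm (β n)).map β.symm
    rwa [β.symm_apply_apply] at this
  · exact hαnn _ hf.nonneg
  · obtain ⟨t, ht, hts⟩ := hf.exists_inv
    exact ⟨β.symm t, hαnn _ ht, by rw [← map_mul, hts, map_one]⟩
  · change _ = f (α n)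
    rw [← hβ, ← hf.trace_right, ← LinearMap.trace_conj' _ β.toLinearEquiv]
    congr 1
    ext x
    simp [LinearEquiv.conj_apply]
  · change _ = f (α y)
    rw [← hf.trace_bimodule, ← LinearMap.trace_conj' _ (AlgEquivClass.toAlgEquiv α : M ≃ₐ[ℂ] M).toLinearEquiv]
    congr 2
    ext x
    change α (y * (α.symm x * α.symm s)) = α y * (x * s)
    simp

variable [FiniteDimensional ℂ M] {tr : M →ₚ[ℂ] ℂ}

/-- For a frame `v` of `N`, the element `∑ vᵢ* vᵢ` has a positive central inverse in `N`. -/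
theorem exists_frame_inverse (h : IsFaithfulTracialState tr) (N : StarSubalgebra ℂ M) :
    ∃ (k : ℕ) (v : Fin k → N) (s : N),
      (∀ x : N, ∑ i, tr (star (v i : M) * x) • v i = x) ∧
      s * ∑ i, star (v i) * v i = 1 ∧ (∀ n : N, Commute s n) ∧ 0 ≤ (s : M) ∧
      (∃ t : N, 0 ≤ (t : M) ∧ t * s = 1) ∧
      ∀ n : N, LinearMap.trace ℂ N (LinearMap.mulRight ℂ (n * s)) = tr n := by
  obtain ⟨k, v, hv⟩ := exists_frame_of_injective h N.subtype.toLinearMap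
    Subtype.val_injective
  replace hv : ∀ x : N, ∑ i, tr (star (v i : M) * x) • v i = x := hv
  obtain ⟨t, ht⟩ : ∃ t, t = ∑ i, star (v i) * v i := ⟨_, rfl⟩
  have htM : (t : M) = ∑ i, star (v i : M) * v i := by
    rw [ht]
    simp
  -- So `t` is the density of the regular trace with respect to `tr`; its inverse will be the
  -- density sought.
  have htr (n : N) : LinearMap.trace ℂ N (LinearMap.mulRight ℂ n) = tr (t * n) := by
    rw [trace_eq_sum_of_frame
      (fun i => tr.toLinearMap ∘ₗ LinearMap.mulLeft ℂ (star (v i : M)) ∘ₗ N.subtype.toLinearMap)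
      v hv]
    simp [htM, Finset.sum_mul, mul_assoc]
  -- The regular trace is tracial, so `t n - n t` is orthogonal to `N`, to which it belongs.
  have hcomm (n : N) : t * n = n * t := by
    apply Subtype.val_injective
    rw [← sub_eq_zero]
    apply h.faithful
    have key (m : N) : tr ((m : M) * (t * n - n * t)) = 0 := by
      have h1 := trace_mulRight_mul_comm n m
      rw [htr, htr] at h1
      simp only [MulMemClass.coe_mul, ← mul_assoc] at h1
      rw [mul_sub, map_sub, sub_eq_zero, h.trace, h1, mul_assoc, h.trace, mul_assoc]
    exact key (star (t * n - n * t))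
  have hinj : Function.Injective (LinearMap.mulLeft ℂ t) := by
    rw [injective_iff_map_eq_zero]
    intro x hx
    have hx' : (t : M) * x = 0 := congrArg Subtype.val hx
    have h1 : ∑ i, tr (star ((v i : M) * x) * (v i * x)) = 0 := by
      have : star (x : M) * (t * x) = 0 := by rw [hx', mul_zero]
      rw [← map_sum, ← map_zero tr, ← this, htM, Finset.sum_mul, Finset.mul_sum]
      congr 1
      exact Finset.sum_congr rfl fun i _ => by rw [star_mul]; noncomm_ring
    rw [Finset.sum_eq_zero_iff_of_nonneg fun i _ => tr.map_nonneg (star_mul_self_nonneg _)] at h1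
    have h2 (i) : v i * x = 0 := Subtype.val_injective (h.faithful _ (h1 i (Finset.mem_univ i)))
    rw [← one_mul x, ← hv 1, Finset.sum_mul]
    exact Finset.sum_eq_zero fun i _ => by rw [smul_mul_assoc, h2, smul_zero]
  obtain ⟨s, hs⟩ := LinearMap.injective_iff_surjective.1 hinj 1
  replace hs : t * s = 1 := hs
  have hst : s * t = 1 := by rw [← hcomm, hs]
  have hsc (n : N) : s * n = n * s :=
    calc s * n = s * n * (t * s) := by rw [hs, mul_one]
      _ = s * (n * t) * s := by noncomm_ring
      _ = (s * t) * n * s := by rw [← hcomm]; noncomm_ring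
      _ = n * s := by rw [hst, one_mul]
  have htnn : 0 ≤ (t : M) := by
    rw [htM]
    exact Finset.sum_nonneg fun i _ => star_mul_self_nonneg _
  have hsM : (t : M) * s = 1 := congrArg Subtype.val hs
  have hsa : star (s : M) = s := by
    have h1 : star (s : M) * t = 1 := by
      have := congrArg star hsM
      rwa [star_mul, (IsSelfAdjoint.of_nonneg htnn).star_eq, star_one] at this
    calc star (s : M) = star (s : M) * (t * s) := by rw [hsM, mul_one]
      _ = s := by rw [← mul_assoc, h1, one_mul]
  refine ⟨k, v, s, hv, ht ▸ hst, hsc, ?_, ⟨t, htnn, hs⟩, fun n => ?_⟩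
  · have : (s : M) = star (s : M) * t * s := by rw [mul_assoc, hsM, mul_one, hsa]
    rw [this]
    exact star_left_conjugate_nonneg htnn _
  · rw [htr, ← hsc, MulMemClass.coe_mul, ← mul_assoc, hsM, one_mul]

/-- The Pimsner–Popa basis of `N ⊆ M` given by a frame of `M`. -/
theorem sum_frame_mul_jonesProj (h : IsFaithfulTracialState tr) {k m : ℕ} {v : Fin k → N} {s : N}
    (hv : ∀ x : N, ∑ i, tr (star (v i : M) * x) • v i = x)
    (hs : s * ∑ i, star (v i) * v i = 1) (hsc : ∀ n : N, Commute s n)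
    {b : Fin m → M} (hb : ∀ x, ∑ j, tr (star (b j) * x) • b j = x) :
    ∑ j, incl N tr (b j * s) * e₁ N tr * incl N tr (star (b j)) = 1 := by
  apply Subtype.val_injective
  rw [AddSubmonoidClass.coe_finsetSum]
  refine ext_toL2 fun x => ?_
  rw [sum_apply]
  have h1 (j) : ((incl N tr (b j * s) * e₁ N tr * incl N tr (star (b j)) :
      basicConstruction N tr) : tr.GNS →L[ℂ] tr.GNS) (toL2 tr x) =
      toL2 tr (b j * s * ∑ i, tr (star (v i : M) * (star (b j) * x)) • (v i : M)) := by
    change tr.gnsStarAlgHom (b j * s) (jonesProj N tr (tr.gnsStarAlgHom (star (b j))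
      (toL2 tr x))) = _
    rw [gnsStarAlgHom_toL2, jonesProj_toL2_frame hv, gnsStarAlgHom_toL2]
  simp only [h1]
  rw [← map_sum]
  change _ = toL2 tr x
  congr 1
  -- Traciality turns the coefficients into those of `x vᵢ*` in the frame of `M`.
  have h2 (i) : ∑ j, tr (star (v i : M) * (star (b j) * x)) • b j = x * star (v i : M) := by
    refine Eq.trans (Finset.sum_congr rfl fun j _ => ?_) (hb (x * star (v i : M)))
    rw [h.trace, mul_assoc]
  have hsM : (s : M) * ∑ i, star (v i : M) * v i = 1 := by
    simpa using congrArg Subtype.val hs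
  calc ∑ j, b j * s * ∑ i, tr (star (v i : M) * (star (b j) * x)) • (v i : M)
      = ∑ i, (∑ j, tr (star (v i : M) * (star (b j) * x)) • b j) * s * v i := by
        simp only [Finset.mul_sum, Finset.sum_mul]
        rw [Finset.sum_comm]
        simp only [mul_smul_comm, smul_mul_assoc]
    _ = ∑ i, x * (s * (star (v i : M) * v i)) := by
        refine Finset.sum_congr rfl fun i _ => ?_
        have h3 : (s : M) * star (v i : M) = star (v i : M) * s :=
          congrArg Subtype.val (hsc (star (v i)))
        rw [h2, ← mul_assoc (s : M), h3]
        noncomm_ring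
    _ = x := by rw [← Finset.mul_sum, ← Finset.mul_sum, hsM, mul_one]

/-- Expand `1` in `Tr (y · 1)` by the Pimsner–Popa identity: each term is `Tr (bⱼ* y bⱼ s e₁) = τ tr
(bⱼ* y bⱼ s)`, and these sum to `τ` times the trace of `x ↦ y x s`. -/
theorem exists_isDensity (h : IsFaithfulTracialState tr) {τ : ℝ}
    {Tr : basicConstruction N tr →ₗ[ℂ] ℂ} (hTr : IsMarkovExtension N tr τ Tr) :
    ∃ s : N, IsDensity N tr.toLinearMap τ s := by
  obtain ⟨k, v, s, hv, hs, hsc, hnn, hinv, htr⟩ := exists_frame_inverse h N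
  obtain ⟨m, b, hb⟩ := exists_frame_of_injective h (LinearMap.id : M →ₗ[ℂ] M)
    Function.injective_id
  replace hb : ∀ x, ∑ j, tr (star (b j) * x) • b j = x := hb
  refine ⟨s, hsc, hnn, hinv, htr, fun y => ?_⟩
  rw [trace_eq_sum_of_frame (fun j => tr.toLinearMap ∘ₗ LinearMap.mulLeft ℂ (star (b j))) b hb]
  change _ = tr y
  rw [← hTr.extends_tr, ← mul_one (incl N tr y), ← sum_frame_mul_jonesProj h hv hs hsc hb,
    Finset.mul_sum (f := fun j => incl N tr (b j * s) * e₁ N tr * incl N tr (star (b j))),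
    map_sum, Finset.mul_sum]
  refine Finset.sum_congr rfl fun j _ => ?_
  rw [← mul_assoc, hTr.trace, ← mul_assoc, ← mul_assoc, ← map_mul, ← map_mul, hTr.markov]
  simp [mul_assoc]

end Density

/-! ### Uniqueness of the Markov trace. -/

section Uniqueness

variable {M : Type*} [CStarAlgebra M] [PartialOrder M] [StarOrderedRing M] [FiniteDimensional ℂ M]
  {tr : M →ₚ[ℂ] ℂ} {N : StarSubalgebra ℂ M}

/-- The trace of `x ↦ q x w` vanishes only if the map does, for `q` a projection and `w ≥ 0`. -/
theorem mul_mul_eq_zero_of_trace_eq_zero (h : IsFaithfulTracialState tr) {q w : M}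
    (hq : IsSelfAdjoint q) (hqq : q * q = q) (hw : 0 ≤ w)
    (h0 : LinearMap.trace ℂ M (LinearMap.mulLeft ℂ q * LinearMap.mulRight ℂ w) = 0) (x : M) :
    q * x * w = 0 := by
  obtain ⟨m, b, hb⟩ := exists_frame_of_injective h (LinearMap.id : M →ₗ[ℂ] M)
    Function.injective_id
  replace hb : ∀ x, ∑ j, tr (star (b j) * x) • b j = x := hb
  obtain ⟨d, hd, rfl⟩ : ∃ d, IsSelfAdjoint d ∧ d * d = w :=
    ⟨CFC.sqrt w, .of_nonneg (CFC.sqrt_nonneg w), CFC.sqrt_mul_sqrt_self w⟩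
  rw [trace_eq_sum_of_frame (fun j => tr.toLinearMap ∘ₗ LinearMap.mulLeft ℂ (star (b j))) b hb]
    at h0
  -- With `d` the square root of `w`, the trace is a sum of squared norms of the `q bⱼ d`.
  have h1 : ∑ j, tr (star (q * b j * d) * (q * b j * d)) = 0 := by
    refine Eq.trans (Finset.sum_congr rfl fun j _ => ?_) h0
    change _ = tr (star (b j) * (q * (b j * (d * d))))
    rw [star_mul, star_mul, hq.star_eq, hd.star_eq, mul_assoc, h.trace]
    congr 1
    calc star (b j) * q * (q * b j * d) * d = star (b j) * (q * q) * b j * d * d := by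
          noncomm_ring
      _ = star (b j) * (q * (b j * (d * d))) := by rw [hqq]; noncomm_ring
  rw [Finset.sum_eq_zero_iff_of_nonneg fun i _ => tr.map_nonneg (star_mul_self_nonneg _)] at h1
  have h2 (j) : q * b j * d = 0 := h.faithful _ (h1 j (Finset.mem_univ j))
  have h3 : q * x * d = 0 := by
    rw [← hb x, Finset.mul_sum, Finset.sum_mul]
    exact Finset.sum_eq_zero fun j _ => by rw [mul_smul_comm, smul_mul_assoc, h2, smul_zero]
  rw [← mul_assoc, h3, zero_mul]

/-- The hypothesis says `q y = q y q` for all `y`; compare this with its adjoint. -/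
theorem commute_of_mul_mul_one_sub_eq_zero {A : Type*} [Ring A] [StarRing A] {q : A}
    (hq : IsSelfAdjoint q) (h : ∀ x, q * x * (1 - q) = 0) (x : A) : Commute q x := by
  have h1 (y : A) : q * y = q * y * q := by
    have := h y
    rwa [mul_sub, mul_one, sub_eq_zero] at this
  have h2 := congrArg star (h1 (star x))
  simp only [star_mul, star_star, hq.star_eq] at h2
  rw [Commute, SemiconjBy, h2, h1 x, mul_assoc]

theorem IsDensity.eq_smul (h : IsFaithfulTracialState tr) (hN : IsConnectedInclusion N)
    {f g : M →ₗ[ℂ] ℂ} {τ : ℂ} {s s' : N} (hf : IsDensity N f τ s) (hg : IsDensity N g τ s')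
    (hτ : τ ≠ 0) : ∃ c : ℝ, s' = (c : ℂ) • s := by
  have : Nontrivial M := by
    refine ⟨0, 1, fun h0 => ?_⟩
    have := h.map_one
    rw [← h0, map_zero] at this
    exact zero_ne_one this
  obtain ⟨t, ht, hts⟩ := hf.exists_inv
  have hst : s * t = 1 := (hf.comm t).eq.trans hts
  have htc (n : N) : t * n = n * t :=
    calc t * n = t * n * (s * t) := by rw [hst, mul_one]
      _ = t * (n * s) * t := by noncomm_ring
      _ = (t * s) * n * t := by rw [← (hf.comm n).eq]; noncomm_ring
      _ = n * t := by rw [hts, one_mul]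
  obtain ⟨u, hu⟩ : ∃ u : N, u = t * s' := ⟨_, rfl⟩
  have hunn : 0 ≤ (u : M) := by
    rw [hu]
    exact Commute.mul_nonneg ht hg.nonneg (congrArg Subtype.val (htc s'))
  have husa : IsSelfAdjoint (u : M) := .of_nonneg hunn
  have huc (n : N) : Commute u n := by
    rw [hu]
    exact Commute.mul_left (htc n) (hg.comm n)
  -- The least spectral value of `u = s⁻¹ s'` gives the largest `c` with `s' - c s ≥ 0`; there `u -
  -- c` stops being invertible.
  obtain ⟨c, hc, hmin⟩ := (spectrum.isCompact (𝕜 := ℝ) (u : M)).exists_isLeast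
    (ContinuousFunctionalCalculus.spectrum_nonempty (u : M) husa)
  refine ⟨c, ?_⟩
  obtain ⟨v, hv⟩ : ∃ v : N, v = u - algebraMap ℂ N c := ⟨_, rfl⟩
  have hvM : (v : M) = u - algebraMap ℝ M c := by
    rw [hv]
    rfl
  have hvnn : 0 ≤ (v : M) := by
    rw [hvM, sub_nonneg]
    exact (algebraMap_le_iff_le_spectrum (ha := husa)).2 hmin
  have hvu : ¬ IsUnit (v : M) := by
    rw [hvM, ← IsUnit.neg_iff, neg_sub]
    exact spectrum.mem_iff.1 hc
  have hvc (n : N) : Commute v n := by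
    rw [hv]
    exact (huc n).sub_left (Algebra.commutes _ _)
  obtain ⟨q, hqv, k, hqsa, hqq, hq0, hqv0, hqk⟩ :=
    exists_kernel_projection (IsSelfAdjoint.of_nonneg hvnn) hvu
  have hqN : q ∈ N := by
    have : Algebra.adjoin ℂ {(v : M)} ≤ N.toSubalgebra :=
      Algebra.adjoin_le (Set.singleton_subset_iff.2 v.2)
    exact this hqv
  have hqc (n : N) : Commute q n := by
    refine Algebra.adjoin_induction (p := fun q _ => Commute q (n : M)) ?_ ?_ ?_ ?_ hqv
    · rintro _ rfl
      exact congrArg Subtype.val (hvc n)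
    · exact fun r => Algebra.commutes _ _
    · exact fun _ _ _ _ h1 h2 => h1.add_left h2
    · exact fun _ _ _ _ h1 h2 => h1.mul_left h2
  obtain ⟨w, hw⟩ : ∃ w : N, w = s' - (c : ℂ) • s := ⟨_, rfl⟩
  have hws : w = s * v := by
    rw [hw, hv, hu, mul_sub, ← mul_assoc, hst, one_mul, Algebra.algebraMap_eq_smul_one,
      mul_smul_comm, mul_one]
  have hwt : w * t = v := by
    rw [hws, mul_assoc, hvc t, ← mul_assoc, hst, one_mul]
  have hwnn : 0 ≤ (w : M) := by
    rw [hws]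
    exact Commute.mul_nonneg hf.nonneg hvnn (congrArg Subtype.val (hf.comm v))
  -- Since `q w = 0`, the formula on `N` gives `g q = c f q`. Subtracting the formulas on `M` leaves
  -- `τ` times this trace.
  have htrace : LinearMap.trace ℂ M
      (LinearMap.mulLeft ℂ q * LinearMap.mulRight ℂ (w : M)) = 0 := by
    have h1 : (⟨q, hqN⟩ : N) * w = 0 := by
      apply Subtype.val_injective
      change q * (w : M) = 0
      rw [hws, hf.comm v]
      change q * ((v : M) * s) = 0
      rw [← mul_assoc, hqv0, zero_mul]
    have h2 := hf.trace_right ⟨q, hqN⟩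
    have h3 := hg.trace_right ⟨q, hqN⟩
    rw [← hf.trace_bimodule] at h2
    rw [← hg.trace_bimodule] at h3
    have h4 : s' = w + (c : ℂ) • s := by rw [hw, sub_add_cancel]
    rw [h4, mul_add, h1, zero_add, mul_smul_comm] at h3
    have h5 (a b : N) : LinearMap.mulRight ℂ ((a + (c : ℂ) • b : N) : M) =
        LinearMap.mulRight ℂ (a : M) + (c : ℂ) • LinearMap.mulRight ℂ (b : M) := by
      ext x
      simp [mul_add]
    have h6 (a : N) : LinearMap.mulRight ℂ ((c : ℂ) • a) = (c : ℂ) • LinearMap.mulRight ℂ a := by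
      ext x
      simp
    rw [h5, h6, map_smul, h2, mul_add, map_add, mul_smul_comm, map_smul, mul_add,
      smul_eq_mul, smul_eq_mul, mul_left_comm, right_eq_add] at h3
    exact (mul_eq_zero.1 h3).resolve_left hτ
  have hqxw := mul_mul_eq_zero_of_trace_eq_zero h hqsa hqq hwnn htrace
  -- Here `1 - q = v k = w t k`, so `q x w = 0` forces `q x (1 - q) = 0`.
  have hcentral : ∀ x, Commute q x := by
    refine commute_of_mul_mul_one_sub_eq_zero hqsa fun x => ?_
    rw [hqk, ← hwt, MulMemClass.coe_mul, ← mul_assoc, ← mul_assoc, hqxw, zero_mul, zero_mul]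
  obtain ⟨a, ha⟩ := hN q hqN (fun y hy => hqc ⟨y, hy⟩) hcentral
  have ha0 : a ≠ 0 := by
    rintro rfl
    exact hq0 (ha.trans (map_zero _))
  -- A nonzero scalar `q` with `q v = 0` leaves `v = 0`, hence `w = s v = 0`.
  have hv0 : v = 0 := by
    apply Subtype.val_injective
    rw [ha, ← Algebra.smul_def] at hqv0
    exact (smul_eq_zero.1 hqv0).resolve_left ha0
  rw [hv0, mul_zero] at hws
  exact sub_eq_zero.1 (hw.symm.trans hws)

/-- Normalised functionals with a density for the same modulus coincide. -/
theorem IsDensity.unique (h : IsFaithfulTracialState tr) (hN : IsConnectedInclusion N)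
    {f g : M →ₗ[ℂ] ℂ} {τ : ℂ} {s s' : N} (hf : IsDensity N f τ s) (hg : IsDensity N g τ s')
    (hf1 : f 1 = 1) (hg1 : g 1 = 1) : f = g := by
  have hτ : τ ≠ 0 := by
    rintro rfl
    have := hf.trace_bimodule 1
    rw [zero_mul, hf1] at this
    exact zero_ne_one this
  obtain ⟨c, rfl⟩ := hf.eq_smul h hN hg hτ
  have h1 (y : M) : g y = c * f y := by
    rw [← hf.trace_bimodule, ← hg.trace_bimodule]
    have : LinearMap.mulRight ℂ (((c : ℂ) • s : N) : M) = (c : ℂ) • LinearMap.mulRight ℂ (s : M) := by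
      ext x
      simp
    rw [this, mul_smul_comm, map_smul, smul_eq_mul, mul_left_comm]
  have h2 := h1 1
  rw [hf1, hg1, mul_one] at h2
  ext y
  rw [h1, ← h2, one_mul]

theorem IsMarkovTrace.comp_starAlgEquiv (hN : IsConnectedInclusion N) {τ : ℝ}
    (htr : IsMarkovTrace N tr τ) (α : M ≃⋆ₐ[ℂ] M) (hα : ∀ x, α x ∈ N ↔ x ∈ N) (x : M) :
    tr (α x) = tr x := by
  obtain ⟨h, Tr, hTr⟩ := htr
  obtain ⟨s, hs⟩ := exists_isDensity h hTr
  obtain ⟨s', hs'⟩ := hs.comp_starAlgEquiv α hα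
  refine (LinearMap.congr_fun (hs.unique h hN hs' h.map_one ?_) x).symm
  change tr (α 1) = 1
  rw [map_one, h.map_one]

end Uniqueness

/-! ### Spanning the basic construction and extending the automorphism. -/

section Extension

variable {M : Type*} [CStarAlgebra M] [PartialOrder M] [StarOrderedRing M]
  {tr : M →ₚ[ℂ] ℂ} {N : StarSubalgebra ℂ M}

/-- The elements of an algebra which leave a subspace invariant under left multiplication. -/
def leftStabilizer {A : Type*} [Ring A] [Algebra ℂ A] (I : Submodule ℂ A) : Subalgebra ℂ A where
  carrier := {a | ∀ z ∈ I, a * z ∈ I}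
  mul_mem' ha hb z hz := by
    rw [mul_assoc]
    exact ha _ (hb z hz)
  add_mem' ha hb z hz := by
    rw [add_mul]
    exact add_mem (ha z hz) (hb z hz)
  algebraMap_mem' r z hz := by
    rw [← Algebra.smul_def]
    exact I.smul_mem r hz

/-- The generating set is closed under the star, so a plain subalgebra containing it is everything.
-/
theorem mem_of_incl_mem_of_e₁_mem (S : Subalgebra ℂ (basicConstruction N tr))
    (h_incl : ∀ x, incl N tr x ∈ S) (h_e₁ : e₁ N tr ∈ S) (a : basicConstruction N tr) : a ∈ S := by
  have ha := a.2
  refine Algebra.adjoin_induction (p := fun x _ => ∀ hx, (⟨x, hx⟩ : basicConstruction N tr) ∈ S)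
    ?_ ?_ ?_ ?_ ha a.2
  · rintro x ((⟨y, rfl⟩ | hx) | ⟨y, hy⟩ | hx) hx'
    · exact h_incl y
    · obtain rfl : x = jonesProj N tr := hx
      exact h_e₁
    · obtain rfl : x = tr.gnsStarAlgHom (star y) := by rw [map_star, hy, star_star]
      exact h_incl _
    · obtain rfl : x = jonesProj N tr := by
        rw [← star_star x, show star x = jonesProj N tr from hx]
        exact (isSelfAdjoint_starProjection (subL2 N tr)).star_eq
      exact h_e₁
  · exact fun r _ => S.algebraMap_mem r
  · exact fun x y hx hy h1 h2 _ => S.add_mem (h1 hx) (h2 hy)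
  · exact fun x y hx hy h1 h2 _ => S.mul_mem (h1 hx) (h2 hy)

theorem IsCompatibleExtension.map_incl_mul_e₁_mul_incl {α : M ≃⋆ₐ[ℂ] M}
    {α₁ : basicConstruction N tr ≃⋆ₐ[ℂ] basicConstruction N tr}
    (h : IsCompatibleExtension N tr α α₁) (x y : M) :
    α₁ (incl N tr x * e₁ N tr * incl N tr y) =
      incl N tr (α x) * e₁ N tr * incl N tr (α y) := by
  rw [map_mul α₁, map_mul α₁, h.map_e₁, h.restrict, h.restrict]

theorem map_basicConstruction {Φ : (tr.GNS →L[ℂ] tr.GNS) ≃⋆ₐ[ℂ] (tr.GNS →L[ℂ] tr.GNS)}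
    {α : M ≃⋆ₐ[ℂ] M} (hM : ∀ x, Φ (tr.gnsStarAlgHom x) = tr.gnsStarAlgHom (α x))
    (he : Φ (jonesProj N tr) = jonesProj N tr) :
    (basicConstruction N tr).map Φ.toStarAlgHom =
      basicConstruction N tr := by
  rw [basicConstruction, StarAlgHom.map_adjoin, Set.image_union, Set.image_singleton,
    ← Set.range_comp]
  congr 2
  · rw [← α.surjective.range_comp tr.gnsStarAlgHom]
    exact congrArg Set.range (funext hM)
  · exact congrArg _ he

variable [FiniteDimensional ℂ M]

theorem e₁_mul_incl_mul_e₁ (h : IsFaithfulTracialState tr) (x : M) :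
    ∃ y : M, e₁ N tr * incl N tr x * e₁ N tr = incl N tr y * e₁ N tr := by
  obtain ⟨y, hy, hxy⟩ := exists_jonesProj_toL2 (N := N) h x
  exact ⟨y, Subtype.ext (jonesProj_mul_gns_mul_jonesProj h hy hxy)⟩

theorem exists_sum_eq_one (h : IsFaithfulTracialState tr) : ∃ (m : ℕ) (x y : Fin m → M),
    ∑ j, incl N tr (x j) * e₁ N tr * incl N tr (y j) = 1 := by
  obtain ⟨k, v, s, hv, hs, hsc, -⟩ := exists_frame_inverse h N
  obtain ⟨m, b, hb⟩ := exists_frame_of_injective h (LinearMap.id : M →ₗ[ℂ] M)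
    Function.injective_id
  replace hb : ∀ x, ∑ j, tr (star (b j) * x) • b j = x := hb
  exact ⟨m, _, _, sum_frame_mul_jonesProj h hv hs hsc hb⟩

/-- In an algebra, the products `f x * e * f y` span a subspace stable under left multiplication by
the range of `f`. -/
theorem map_mem_leftStabilizer_span {A B : Type*} [Ring A] [Algebra ℂ A] [Ring B] [Algebra ℂ B]
    (f : A →ₐ[ℂ] B) (e : B) (x : A) :
    f x ∈ leftStabilizer (Submodule.span ℂ (Set.range fun p : A × A => f p.1 * e * f p.2)) := by
  intro z hz
  refine Submodule.span_induction (p := fun z _ => f x * z ∈ _) ?_ ?_ ?_ ?_ hz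
  · rintro _ ⟨p, rfl⟩
    refine Submodule.subset_span ⟨(x * p.1, p.2), ?_⟩
    simp [mul_assoc]
  · rw [mul_zero]
    exact zero_mem _
  · intro a b _ _ ha hb
    rw [mul_add]
    exact add_mem ha hb
  · intro r a _ ha
    rw [mul_smul_comm]
    exact Submodule.smul_mem _ r ha

theorem mem_leftStabilizer_span {A B : Type*} [Ring A] [Algebra ℂ A] [Ring B] [Algebra ℂ B]
    (f : A →ₐ[ℂ] B) (e : B) (he : ∀ x, ∃ y, e * f x * e = f y * e) :
    e ∈ leftStabilizer (Submodule.span ℂ (Set.range fun p : A × A => f p.1 * e * f p.2)) := by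
  intro z hz
  refine Submodule.span_induction (p := fun z _ => e * z ∈ _) ?_ ?_ ?_ ?_ hz
  · rintro _ ⟨p, rfl⟩
    obtain ⟨y, hy⟩ := he p.1
    refine Submodule.subset_span ⟨(y, p.2), ?_⟩
    simp only [← mul_assoc, hy]
  · rw [mul_zero]
    exact zero_mem _
  · intro a b _ _ ha hb
    rw [mul_add]
    exact add_mem ha hb
  · intro r a _ ha
    rw [mul_smul_comm]
    exact Submodule.smul_mem _ r ha

theorem eq_top_of_leftStabilizer {B : Type*} [Ring B] [Algebra ℂ B] {I : Submodule ℂ B}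
    (hI : ∀ a, a ∈ leftStabilizer I) (h1 : 1 ∈ I) : I = ⊤ :=
  Submodule.eq_top_iff'.2 fun a => mul_one a ▸ hI a 1 h1

/-- The basic construction is spanned by the products `x e₁ y` with `x, y ∈ M`. -/
theorem span_incl_mul_e₁_mul_incl (h : IsFaithfulTracialState tr) :
    Submodule.span ℂ (Set.range fun p : M × M => incl N tr p.1 * e₁ N tr * incl N tr p.2) = ⊤ := by
  refine eq_top_of_leftStabilizer (mem_of_incl_mem_of_e₁_mem _
    (map_mem_leftStabilizer_span (incl N tr).toAlgHom (e₁ N tr))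
    (mem_leftStabilizer_span (incl N tr).toAlgHom (e₁ N tr) (e₁_mul_incl_mul_e₁ h))) ?_
  obtain ⟨m, x, y, hxy⟩ := exists_sum_eq_one (N := N) h
  rw [← hxy]
  exact sum_mem fun j _ => Submodule.subset_span ⟨(x j, y j), rfl⟩

theorem linearMap_ext_basicConstruction (h : IsFaithfulTracialState tr) {V : Type*}
    [AddCommGroup V] [Module ℂ V] {F G : basicConstruction N tr →ₗ[ℂ] V}
    (hFG : ∀ x y : M, F (incl N tr x * e₁ N tr * incl N tr y) =
      G (incl N tr x * e₁ N tr * incl N tr y)) : F = G :=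
  LinearMap.ext_on (span_incl_mul_e₁_mul_incl h) (by rintro _ ⟨p, rfl⟩; exact hFG p.1 p.2)

/-- The unitary of `L²(M, tr)` implementing a trace-preserving automorphism. -/
theorem exists_unitary (h : IsFaithfulTracialState tr) (α : M ≃⋆ₐ[ℂ] M)
    (hα : ∀ x, tr (α x) = tr x) :
    ∃ U : tr.GNS ≃ₗᵢ[ℂ] tr.GNS, ∀ x, U (toL2 tr x) = toL2 tr (α x) := by
  let J := LinearEquiv.ofBijective (toL2 tr) ⟨toL2_injective h, toL2_surjective⟩
  let A := J.symm.trans ((AlgEquivClass.toAlgEquiv α : M ≃ₐ[ℂ] M).toLinearEquiv.trans J)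
  have hA (x : M) : A (toL2 tr x) = toL2 tr (α x) := by
    change J (α (J.symm (J x))) = _
    rw [J.symm_apply_apply]
    rfl
  refine ⟨A.isometryOfInner fun ξ η => ?_, hA⟩
  obtain ⟨x, rfl⟩ := toL2_surjective ξ
  obtain ⟨y, rfl⟩ := toL2_surjective η
  rw [hA, hA, inner_toL2, inner_toL2, ← map_star, ← map_mul, hα]

/-- The unitary maps both `L²(N)` and its orthogonal complement to themselves, as `α` preserves `N`
and `tr`. -/
theorem conj_jonesProj (h : IsFaithfulTracialState tr) (α : M ≃⋆ₐ[ℂ] M)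
    (hα : ∀ x, tr (α x) = tr x) (hαN : ∀ x, α x ∈ N ↔ x ∈ N) {U : tr.GNS ≃ₗᵢ[ℂ] tr.GNS}
    (hU : ∀ x, U (toL2 tr x) = toL2 tr (α x)) :
    U.conjStarAlgEquiv (jonesProj N tr) = jonesProj N tr := by
  refine ext_toL2 fun x => ?_
  obtain ⟨z, rfl⟩ : ∃ z, α z = x := ⟨α.symm x, by simp⟩
  obtain ⟨y, hy, hz⟩ := exists_jonesProj_toL2 (N := N) h z
  rw [LinearIsometryEquiv.conjStarAlgEquiv_apply_apply, ← hU, U.symm_apply_apply, hz, hU, hU]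
  refine (jonesProj_toL2_eq ((hαN y).2 hy) fun n hn => ?_).symm
  obtain ⟨m, rfl⟩ : ∃ m, α m = n := ⟨α.symm n, by simp⟩
  rw [← map_sub, ← map_mul, hα]
  exact trace_mul_sub_eq_zero hz ((hαN m).1 hn)

theorem conj_gnsStarAlgHom (α : M ≃⋆ₐ[ℂ] M) {U : tr.GNS ≃ₗᵢ[ℂ] tr.GNS}
    (hU : ∀ x, U (toL2 tr x) = toL2 tr (α x)) (x : M) :
    U.conjStarAlgEquiv (tr.gnsStarAlgHom x) = tr.gnsStarAlgHom (α x) := by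
  refine ext_toL2 fun y => ?_
  obtain ⟨z, rfl⟩ : ∃ z, α z = y := ⟨α.symm y, by simp⟩
  rw [LinearIsometryEquiv.conjStarAlgEquiv_apply_apply, ← hU, U.symm_apply_apply,
    gnsStarAlgHom_toL2, hU, hU, gnsStarAlgHom_toL2, map_mul]

theorem exists_isCompatibleExtension (h : IsFaithfulTracialState tr) (α : M ≃⋆ₐ[ℂ] M)
    (hα : ∀ x, tr (α x) = tr x) (hαN : ∀ x, α x ∈ N ↔ x ∈ N) :
    ∃ α₁ : basicConstruction N tr ≃⋆ₐ[ℂ] basicConstruction N tr,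
      IsCompatibleExtension N tr α α₁ := by
  obtain ⟨U, hU⟩ := exists_unitary h α hα
  have hM := conj_gnsStarAlgHom α hU
  have he := conj_jonesProj h α hα hαN hU
  have hmap := map_basicConstruction hM he
  obtain ⟨Φ, hΦ⟩ : ∃ Φ, Φ = U.conjStarAlgEquiv := ⟨_, rfl⟩
  rw [← hΦ] at hM he hmap
  have hmem (x : tr.GNS →L[ℂ] tr.GNS) :
      Φ x ∈ basicConstruction N tr ↔ x ∈ basicConstruction N tr := by
    constructor
    · intro hx
      have h1 : Φ x ∈ (basicConstruction N tr).map Φ.toStarAlgHom := by rwa [hmap]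
      obtain ⟨z, hz, hzx⟩ := h1
      rwa [← Φ.injective hzx]
    · intro hx
      have h1 : Φ x ∈ (basicConstruction N tr).map Φ.toStarAlgHom := ⟨x, hx, rfl⟩
      rwa [hmap] at h1
  let φ : basicConstruction N tr →⋆ₐ[ℂ] basicConstruction N tr :=
    (Φ.toStarAlgHom.comp (basicConstruction N tr).subtype).codRestrict (basicConstruction N tr)
      fun x => (hmem x).2 x.2
  have hbij : Function.Bijective φ := by
    refine ⟨fun x y hxy => Subtype.val_injective (Φ.injective (congrArg Subtype.val hxy)),
      fun y => ?_⟩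
    obtain ⟨x, hx⟩ : ∃ x, Φ x = y := ⟨Φ.symm y, Φ.apply_symm_apply y⟩
    exact ⟨⟨x, (hmem x).1 (hx ▸ y.2)⟩, Subtype.val_injective hx⟩
  have hr (x : M) : StarAlgEquiv.ofBijective φ hbij (incl N tr x) = incl N tr (α x) :=
    Subtype.val_injective (hM x)
  refine ⟨StarAlgEquiv.ofBijective φ hbij, Subtype.val_injective he, ?_, hr⟩
  rw [← Set.range_comp, ← α.surjective.range_comp (incl N tr)]
  exact congrArg Set.range (funext hr)

end Extension

end JonesTower

end

theorem mainTheorem4 {M : Type*} [CStarAlgebra M] [PartialOrder M] [StarOrderedRing M]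
    [FiniteDimensional ℂ M] (N : StarSubalgebra ℂ M) (hN : JonesTower.IsConnectedInclusion N)
    (tr : M →ₚ[ℂ] ℂ) (τ : ℝ) (htr : JonesTower.IsMarkovTrace N tr τ)
    (α₀ : M ≃⋆ₐ[ℂ] M) (hα₀ : α₀ '' (N : Set M) = N) :
    ∃ α₁ : JonesTower.basicConstruction N tr ≃⋆ₐ[ℂ] JonesTower.basicConstruction N tr,
      JonesTower.IsCompatibleExtension N tr α₀ α₁ ∧
      (∀ Tr : JonesTower.basicConstruction N tr →ₗ[ℂ] ℂ,
        JonesTower.IsMarkovExtension N tr τ Tr → ∀ x, Tr (α₁ x) = Tr x) ∧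
      ∀ β : JonesTower.basicConstruction N tr ≃⋆ₐ[ℂ] JonesTower.basicConstruction N tr,
        JonesTower.IsCompatibleExtension N tr α₀ β → β = α₁ := by
  have hαN (x : M) : α₀ x ∈ N ↔ x ∈ N := by
    rw [← SetLike.mem_coe, ← hα₀]
    exact α₀.injective.mem_set_image
  have hα := htr.comp_starAlgEquiv hN α₀ hαN
  obtain ⟨α₁, h1⟩ := JonesTower.exists_isCompatibleExtension htr.1 α₀ hα hαN
  refine ⟨α₁, h1, fun Tr hTr x => ?_, fun β hβ => ?_⟩
  -- The Markov property and traciality determine `Tr` on the spanning products, through `tr` alone.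
  · have key (x y : M) : Tr (JonesTower.incl N tr x * JonesTower.e₁ N tr * JonesTower.incl N tr y) =
        τ * tr (y * x) := by
      rw [hTr.trace, ← mul_assoc, ← map_mul, hTr.markov]
    refine LinearMap.congr_fun (JonesTower.linearMap_ext_basicConstruction htr.1
      (F := Tr ∘ₗ α₁.toAlgEquiv.toLinearMap)
      (G := Tr) fun x y => ?_) x
    change Tr (α₁ _) = _
    rw [h1.map_incl_mul_e₁_mul_incl, key, key, ← map_mul, hα]
  · have := JonesTower.linearMap_ext_basicConstruction htr.1
      (F := β.toAlgEquiv.toLinearMap)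
      (G := α₁.toAlgEquiv.toLinearMap)
      fun x y => ?_
    · ext1 x
      exact LinearMap.congr_fun this x
    · change β _ = α₁ _
      rw [h1.map_incl_mul_e₁_mul_incl, hβ.map_incl_mul_e₁_mul_incl]
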